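/- Let $K$ be a field of characteristic zero with $n\ge 1$ commuting derivations $\partial_1,\dots,\partial_n$, let $D=K[d_1,\dots,d_n]$ be the ring of differential operators over $K$ (generated by $K$ and commuting $d_1,\dots,d_n$ with $d_ia=ad_i+\partial_ia$ for $a\in K$), and let $y^1,\dots,y^m$ be the canonical basis of the free left module $Dy=D^m$; write $y^k_i=d_iy^k$ and $y^k_0=y^k$. A jet $y^k_i$ with $1\le i\le n$ has class $i$. Consider a first-order linear system $\Phi^1=\dots=\Phi^p=0$, $\Phi^\tau=\sum_{k}\sum_{i=0}^{n}\Phi^{\tau i}_k\,y^k_i$ with $\Phi^{\tau i}_k\in K$, without zero-order equations, arranged by classes: each $\Phi^\tau$ has a class $i\in\{1,\dots,n\}$, it contains no jet of class $>i$, and the equations of class $i$ are solved with respect to jets $y^k_i$ of class $i$ (each contains its own leading jet with coefficient $1$, and not the leading jets of the other equations of class $i$). Suppose that the system is involutive, i.e. every $d_j\Phi^\tau$ is a $K$-linear combination of the $\Phi^\sigma$ and of the $d_i\Phi^\sigma$ with $i\le$ class of $\Phi^\sigma$. Suppose finally that there are $\beta<m$ equations of class $n$ and that they are solved with respect to $y^1_n,\dots,y^\beta_n$.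 Write the equation solved with respect to $y^k_n$ as $y^k_n-\sum_{l=\beta+1}^m a^k_l\,y^l_n+(\text{terms in } y^r_i,\ 0\le i\le n-1)=0$, and set $$\bar y^k=y^k-\sum_{l=\beta+1}^m a^k_l\,y^l\quad(1\le k\le\beta),\qquad \bar y^l=y^l\quad(\beta<l\le m).$$ Then: 1. Each $\Phi^\tau$ can be written in exactly one way as a $K$-linear combination of the $\bar y^k_i=d_i\bar y^k$ ($1\le k\le m$, $0\le i\le n$, $\bar y^k_0=\bar y^k$). In the equations of class $n$ so rewritten, the equation solved with respect to $y^k_n$ contains among $\bar y^1_n,\dots,\bar y^\beta_n$ only $\bar y^k_n$, with coefficient $1$, and the inputs $y^{\beta+1},\dots,y^m$ occur only through $y^l_i$ with $0\le i\le n-1$. The rewritten equations of class $i\le n-1$ contain no jet of class $>i$, and contain neither $y^{\beta+1},\dots,y^m$ nor any of their jets. 2. Every torsion element $z$ of the differential module $M=Dy/(D\Phi^1+\dots+D\Phi^p)$ (that is, $Pz=0$ for some $0\ne P\in D$) only depends on $\bar y^1,\dots,\bar y^\beta$: it is the class of $\sum_{k=1}^\beta Q_k\bar y^k$ for some $Q_1,\dots,Q_\beta\in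 K[d_1,\dots,d_{n-1}]\subseteq D$. -/

import Mathlib

noncomputable section

namespace SpencerForm

variable {K : Type*} [Field K] {n : ℕ}

/-- The defining relations of the ring `D = K[d_1, …, d_n]` of differential operators, on the free
ring generated by symbols for the elements of `K` and for `d_1, …, d_n`: the symbols of `K` multiply
and add as in `K`, the `d_i` commute, and `d_i a = a d_i + ∂_i a`. -/
inductive DiffOpRel (der : Fin n → Derivation ℤ K K) :
    FreeAlgebra ℤ (K ⊕ Fin n) → FreeAlgebra ℤ (K ⊕ Fin n) → Prop
  | one : DiffOpRel der (FreeAlgebra.ι ℤ (Sum.inl 1)) 1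
  | add (a b : K) : DiffOpRel der (FreeAlgebra.ι ℤ (Sum.inl (a + b)))
      (FreeAlgebra.ι ℤ (Sum.inl a) + FreeAlgebra.ι ℤ (Sum.inl b))
  | mul (a b : K) : DiffOpRel der (FreeAlgebra.ι ℤ (Sum.inl (a * b)))
      (FreeAlgebra.ι ℤ (Sum.inl a) * FreeAlgebra.ι ℤ (Sum.inl b))
  | comm (i j : Fin n) : DiffOpRel der
      (FreeAlgebra.ι ℤ (Sum.inr i) * FreeAlgebra.ι ℤ (Sum.inr j))
      (FreeAlgebra.ι ℤ (Sum.inr j) * FreeAlgebra.ι ℤ (Sum.inr i))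
  | leibniz (i : Fin n) (a : K) : DiffOpRel der
      (FreeAlgebra.ι ℤ (Sum.inr i) * FreeAlgebra.ι ℤ (Sum.inl a))
      (FreeAlgebra.ι ℤ (Sum.inl a) * FreeAlgebra.ι ℤ (Sum.inr i)
        + FreeAlgebra.ι ℤ (Sum.inl (der i a)))

/-- The ring `D = K[d_1, …, d_n]` of differential operators over the differential field
`(K, ∂_1, …, ∂_n)`. -/
def DiffOp (der : Fin n → Derivation ℤ K K) : Type _ := RingQuot (DiffOpRel der)

instance (der : Fin n → Derivation ℤ K K) : Ring (DiffOp der) :=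
  inferInstanceAs (Ring (RingQuot (DiffOpRel der)))

/-- The operator `d_i`. -/
def dop (der : Fin n → Derivation ℤ K K) (i : Fin n) : DiffOp der :=
  RingQuot.mkRingHom (DiffOpRel der) (FreeAlgebra.ι ℤ (Sum.inr i))

/-- The inclusion of the coefficients `K` in `D` as operators of order zero. -/
def coeff (der : Fin n → Derivation ℤ K K) : K →+* DiffOp der where
  toFun a := RingQuot.mkRingHom (DiffOpRel der) (FreeAlgebra.ι ℤ (Sum.inl a))
  map_one' := by
    rw [RingQuot.mkRingHom_rel (DiffOpRel.one (der := der)), map_one]; rfl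
  map_mul' a b := by
    rw [RingQuot.mkRingHom_rel (DiffOpRel.mul (der := der) a b), map_mul]; rfl
  map_zero' := by
    have h := RingQuot.mkRingHom_rel (DiffOpRel.add (der := der) 0 0)
    rw [map_add, add_zero] at h
    exact left_eq_add.mp h
  map_add' a b := by
    rw [RingQuot.mkRingHom_rel (DiffOpRel.add (der := der) a b), map_add]; rfl

/-- `D` is a left `K`-vector space, `K` acting by left multiplication. -/
instance (der : Fin n → Derivation ℤ K K) : Module K (DiffOp der) :=
  Module.compHom (DiffOp der) (coeff der)

/-- A linear differential expression of order at most one in `m` unknowns: `φ (some i) k ∈ K` is the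
coefficient of the jet `y^k_i` and `φ none k ∈ K` is the coefficient of `y^k = y^k_0`. -/
abbrev Jet1 (K : Type*) (n m : ℕ) : Type _ := Option (Fin n) → Fin m → K

variable {m p : ℕ}

/-- The operator producing the jets with a given index: `1` for the index `0`, and `d_i`. -/
def jetOp (der : Fin n → Derivation ℤ K K) : Option (Fin n) → DiffOp der
  | none => 1
  | some i => dop der i

/-- The differential indeterminates `y^1, …, y^m`, the canonical basis of `D^m = Dy`. -/
def unk (der : Fin n → Derivation ℤ K K) (m : ℕ) (k : Fin m) : Fin m → DiffOp der :=
  Pi.single k 1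

/-- The expression `φ` with the elements `u^1, …, u^m` of `D^m` substituted for the unknowns:
`∑ φ^i_k d_i u^k + ∑ φ_k u^k`. -/
def subst (der : Fin n → Derivation ℤ K K) (u : Fin m → (Fin m → DiffOp der))
    (φ : Jet1 K n m) : Fin m → DiffOp der :=
  ∑ j : Option (Fin n), ∑ k : Fin m, φ j k • (jetOp der j • u k)

/-- The left-hand side `Φ(y) ∈ Dy` of an equation. -/
def lhs (der : Fin n → Derivation ℤ K K) (φ : Jet1 K n m) : Fin m → DiffOp der :=
  subst der (unk der m) φ

/-- The equations `Φ^1 = 0, …, Φ^p = 0` of order one, none of order zero, are arranged by classes and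
solved: `Φ^τ` is of class `cls τ`, i.e. contains no jet of a higher class, and the equations of class
`i` are solved with respect to the jets `y^k_i` with `k = lead τ`, one for each of them. (The number
of equations of class `i` is then the greatest possible, and no nonzero `K`-linear combination of
the equations has order zero.) -/
structure IsSolved (Φ : Fin p → Jet1 K n m) (cls : Fin p → Fin n) (lead : Fin p → Fin m) :
    Prop where
  no_higher : ∀ τ i k, cls τ < i → Φ τ (some i) k = 0
  solved : ∀ τ σ, cls τ = cls σ → Φ τ (some (cls σ)) (lead σ) = if τ = σ then 1 else 0

/-- Involution of a system arranged by classes: `x^1, …, x^i` being the multiplicative variables of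
an equation of class `i`, all the first prolongations `d_j Φ^τ` are `K`-linear combinations of the
equations and of their prolongations with respect to multiplicative variables. -/
def IsInvolutive (der : Fin n → Derivation ℤ K K) (Φ : Fin p → Jet1 K n m)
    (cls : Fin p → Fin n) : Prop :=
  ∀ τ j, dop der j • lhs der (Φ τ) ∈ Submodule.span K
    ({v | ∃ σ, v = lhs der (Φ σ)} ∪
      {v | ∃ σ i, i ≤ cls σ ∧ v = dop der i • lhs der (Φ σ)})

/-- The modified unknowns. If the equation of class `n` solved with respect to `y^k_n` is
`y^k_n - ∑_{l > β} a^k_l y^l_n + … = 0`, then `ȳ^k = y^k - ∑_{l > β} a^k_l y^l`; the unknowns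
with respect to which no equation of class `n` is solved are not changed. (Numbering from zero,
`l > β` becomes `β ≤ l`.) -/
def ybar (der : Fin (n + 1) → Derivation ℤ K K) (Φ : Fin p → Jet1 K (n + 1) m)
    (cls : Fin p → Fin (n + 1)) (lead : Fin p → Fin m) (β : ℕ) (k : Fin m) :
    Fin m → DiffOp der :=
  unk der m k + ∑ τ with cls τ = Fin.last n ∧ lead τ = k, ∑ l : Fin m with β ≤ l.val,
    Φ τ (some (Fin.last n)) l • unk der m l

/-- The module of equations `I = DΦ ⊆ Dy`. -/
def eqModule (der : Fin n → Derivation ℤ K K) (Φ : Fin p → Jet1 K n m) :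
    Submodule (DiffOp der) (Fin m → DiffOp der) :=
  Submodule.span (DiffOp der) (Set.range fun τ => lhs der (Φ τ))

/-- The differential module `M = Dy / DΦ` of the system. -/
abbrev DiffModule (der : Fin n → Derivation ℤ K K) (Φ : Fin p → Jet1 K n m) : Type _ :=
  (Fin m → DiffOp der) ⧸ eqModule der Φ

/-- `z` is a torsion element: it is killed by a nonzero differential operator. -/
def IsTorsionElement (der : Fin n → Derivation ℤ K K) (Φ : Fin p → Jet1 K n m)
    (z : DiffModule der Φ) : Prop :=
  ∃ P : DiffOp der, P ≠ 0 ∧ P • z = 0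

/-- The subring `K[d_1, …, d_{n-1}]` of `K[d_1, …, d_n]`. -/
def lowerOps (der : Fin (n + 1) → Derivation ℤ K K) : Subring (DiffOp der) :=
  Subring.closure (Set.range (coeff der) ∪ {P | ∃ i, i ≠ Fin.last n ∧ P = dop der i})

end SpencerForm

end

open SpencerForm

noncomputable section

namespace SpencerForm

open MvPolynomial
open scoped MonomialOrder

/-! ### Normal forms of operators and additivity of leading exponents -/

section Operators

variable {K : Type*} [Field K] {n : ℕ} (der : Fin n → Derivation ℤ K K)

/-! Let `D' = K[d_1, …, d_{n-1}]`, and measure operators by their degree in `d_n`. Left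
multiplication on normal forms represents `D` on polynomials, and leading exponents add under
products; for the lexicographic order with the last variable greatest, this makes `D` a domain in
which the degree in `d_n` is additive.

In the new unknowns, an equation of class `n` is `d_n ȳ^k` plus terms with coefficients in `D'`, and
an equation of lower class has all its coefficients in `D'`. Involution and `[d_n, D'] ⊆ D'` show
that every consequence of the system is a combination in which the equations of lower class have
coefficients in `D'` (`eqModule_le_restrictedCombinations`). If the coordinates of such a
combination along `ȳ^1, …, ȳ^β` have degree at most `r`, the nonzero coefficients of the equations
of class `n` have degree less than `r` (`coefficient_topDegree_lt`). Two comparisons of degrees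
along an input then finish.

Writing `d_n Φ^τ`, for `Φ^τ` of lower class, as such a combination, `r = 1` makes the right side
have degree `0` along every input, while the left side is `d_n` times a coefficient of `Φ^τ`: that
coefficient vanishes (`row_rewriteJet_eq_zero`). For torsion, the equations of class `n` reduce `z`
to `∑ V_k ȳ^k` with `V_k ∈ D'` for `k ≤ β` (`exists_reduced`). If `Pz = 0`, take `r = deg P`: along
an input, `P V_l` is a sum of terms of degree less than `deg P`, so `V_l = 0`
(`reduced_torsion_eq_zero`). -/

theorem dop_mul_coeff (i : Fin n) (a : K) :
    dop der i * coeff der a = coeff der a * dop der i + coeff der (der i a) := by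
  have h := RingQuot.mkRingHom_rel (DiffOpRel.leibniz (der := der) i a)
  rw [map_mul, map_add, map_mul] at h
  exact h

theorem commute_dop (i j : Fin n) : Commute (dop der i) (dop der j) := by
  have h := RingQuot.mkRingHom_rel (DiffOpRel.comm (der := der) i j)
  rw [map_mul, map_mul] at h
  exact h

/-- Induction on differential operators, built from coefficients and the `d_i`. -/
theorem DiffOp.induction {motive : DiffOp der → Prop} (coeff' : ∀ a, motive (coeff der a))
    (dop' : ∀ i, motive (dop der i)) (add : ∀ P Q, motive P → motive Q → motive (P + Q))
    (mul : ∀ P Q, motive P → motive Q → motive (P * Q)) (P : DiffOp der) : motive P := by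
  obtain ⟨x, rfl⟩ := RingQuot.mkRingHom_surjective (DiffOpRel der) P
  induction x using FreeAlgebra.induction with
  | grade0 r =>
    have h : RingQuot.mkRingHom (DiffOpRel der) (algebraMap ℤ _ r) = coeff der (r : K) := by
      rw [map_intCast (coeff der), eq_intCast, map_intCast]; rfl
    rw [h]; exact coeff' _
  | grade1 x => exact x.rec coeff' dop'
  | mul a b ha hb => rw [map_mul]; exact mul _ _ ha hb
  | add a b ha hb => rw [map_add]; exact add _ _ ha hb

/-- The derivation `∂_i` applied to the coefficients of a polynomial. -/
def coeffDer (i : Fin n) : Module.End ℤ (MvPolynomial (Fin n) K) where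
  toFun f := AddMonoidAlgebra.map (der i).toLinearMap.toAddMonoidHom f
  map_add' f g := by ext; exact map_add (der i) _ _
  map_smul' k f := by ext; exact map_zsmul (der i) _ _

@[simp]
theorem coeff_coeffDer (i : Fin n) (f : MvPolynomial (Fin n) K) (μ : Fin n →₀ ℕ) :
    MvPolynomial.coeff μ (coeffDer der i f) = der i (MvPolynomial.coeff μ f) := rfl

theorem coeffDer_X_mul (i j : Fin n) (f : MvPolynomial (Fin n) K) :
    coeffDer der i (X j * f) = X j * coeffDer der i f := by
  ext μ
  rw [coeff_coeffDer, coeff_X_mul', coeff_X_mul']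
  split_ifs <;> simp

theorem coeffDer_C_mul (i : Fin n) (a : K) (f : MvPolynomial (Fin n) K) :
    coeffDer der i (C a * f) = C a * coeffDer der i f + C (der i a) * f := by
  ext μ
  rw [coeff_coeffDer, coeff_C_mul, MvPolynomial.coeff_add, coeff_C_mul, coeff_C_mul,
    coeff_coeffDer, Derivation.leibniz]
  simp [mul_comm]

/-- The action of a coefficient on symbols. -/
def symbolCoeff (a : K) : Module.End ℤ (MvPolynomial (Fin n) K) :=
  LinearMap.mulLeft ℤ (C a)

theorem symbolCoeff_apply (a : K) (f : MvPolynomial (Fin n) K) :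
    symbolCoeff a f = C a * f := rfl

/-- The action of `d_i` on symbols by left multiplication of operators in normal form. -/
def symbolDop (i : Fin n) : Module.End ℤ (MvPolynomial (Fin n) K) :=
  LinearMap.mulLeft ℤ (X i) + coeffDer der i

theorem symbolDop_apply (i : Fin n) (f : MvPolynomial (Fin n) K) :
    symbolDop der i f = X i * f + coeffDer der i f := rfl

variable (hcomm : ∀ i j a, der i (der j a) = der j (der i a))

/-- The action of the ring of differential operators on symbols. -/
def rep : DiffOp der →+* Module.End ℤ (MvPolynomial (Fin n) K) :=
  RingQuot.lift ⟨(FreeAlgebra.lift ℤ (Sum.elim symbolCoeff (symbolDop der)) :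
      FreeAlgebra ℤ (K ⊕ Fin n) →ₐ[ℤ] Module.End ℤ (MvPolynomial (Fin n) K)).toRingHom, by
    intro x y h
    refine LinearMap.ext fun f => ?_
    cases h with
    | one => simp [symbolCoeff_apply]
    | add a b => simp [symbolCoeff_apply, add_mul]
    | mul a b => simp [symbolCoeff_apply, mul_assoc]
    | comm i j =>
      have h : coeffDer der i (coeffDer der j f) = coeffDer der j (coeffDer der i f) := by
        ext μ; exact hcomm i j _
      simp [symbolDop_apply, coeffDer_X_mul, h]
      ring
    | leibniz i a =>
      simp [symbolDop_apply, symbolCoeff_apply, coeffDer_C_mul]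
      ring⟩

theorem rep_mul_apply (P Q : DiffOp der) (f : MvPolynomial (Fin n) K) :
    rep der hcomm (P * Q) f = rep der hcomm P (rep der hcomm Q f) := by
  rw [map_mul]; rfl

theorem rep_coeff (a : K) (f : MvPolynomial (Fin n) K) :
    rep der hcomm (coeff der a) f = C a * f := by
  have h : rep der hcomm (coeff der a) = symbolCoeff a := by
    refine (RingQuot.lift_mkRingHom_apply _ _ _).trans ?_
    simp
  rw [h]; rfl

theorem rep_dop (i : Fin n) (f : MvPolynomial (Fin n) K) :
    rep der hcomm (dop der i) f = X i * f + coeffDer der i f := by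
  have h : rep der hcomm (dop der i) = symbolDop der i := by
    refine (RingQuot.lift_mkRingHom_apply _ _ _).trans ?_
    simp
  rw [h]; rfl

/-- The monomial operators `d^μ`. -/
def dpow : (Fin n → Multiplicative ℕ) →* DiffOp der :=
  MonoidHom.noncommPiCoprod (fun i => powersHom (DiffOp der) (dop der i)) (by
    intro i j _ x y
    simpa using (commute_dop der i j).pow_pow _ _)

theorem dpow_mulSingle (i : Fin n) (k : ℕ) :
    dpow der (Pi.mulSingle i (.ofAdd k)) = dop der i ^ k :=
  MonoidHom.noncommPiCoprod_mulSingle ..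

/-- The operator with a given symbol, coefficients being written on the left. -/
def ofSymbol : MvPolynomial (Fin n) K →+ DiffOp der where
  toFun f := (AddMonoidAlgebra.coeff f).sum fun μ a => coeff der a * dpow der fun i => .ofAdd (μ i)
  map_zero' := by simp
  map_add' f g := by
    simp only [AddMonoidAlgebra.coeff_add]
    exact Finsupp.sum_add_index' (by simp) (by simp [add_mul])

theorem ofSymbol_monomial (μ : Fin n →₀ ℕ) (a : K) :
    ofSymbol der (monomial μ a) = coeff der a * dpow der fun i => .ofAdd (μ i) := by
  refine Finsupp.sum_single_index
    (h := fun (μ : Fin n →₀ ℕ) a => coeff der a * dpow der fun i => .ofAdd (μ i)) ?_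
  rw [map_zero, zero_mul]

theorem dpow_single_add (i : Fin n) (μ : Fin n →₀ ℕ) :
    (dpow der fun j => .ofAdd ((Finsupp.single i 1 + μ : Fin n →₀ ℕ) j)) =
      dop der i * dpow der fun j => .ofAdd (μ j) := by
  have h : (fun j => Multiplicative.ofAdd ((Finsupp.single i 1 + μ : Fin n →₀ ℕ) j)) =
      Pi.mulSingle i (.ofAdd 1) * fun j => .ofAdd (μ j) := by
    funext j
    by_cases hij : j = i
    · subst hij; simp [ofAdd_add]
    · simp [hij]
  rw [h, map_mul, dpow_mulSingle, pow_one]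

/-- The action on symbols was designed to be left multiplication transported through normal forms.
Evaluated at `1`, this makes `ofSymbol` a left inverse of `symbol`, so nonzero operators have
nonzero symbols. -/
theorem ofSymbol_rep (P : DiffOp der) (f : MvPolynomial (Fin n) K) :
    ofSymbol der (rep der hcomm P f) = P * ofSymbol der f := by
  induction P using DiffOp.induction generalizing f with
  | coeff' a =>
    rw [rep_coeff]
    induction f using MvPolynomial.induction_on' with
    | monomial μ b => rw [C_mul_monomial, ofSymbol_monomial, ofSymbol_monomial, map_mul, mul_assoc]
    | add f g hf hg => rw [mul_add, map_add, hf, hg, map_add, mul_add]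
  | dop' i =>
    rw [rep_dop]
    induction f using MvPolynomial.induction_on' with
    | monomial μ b =>
      have h : coeffDer der i (monomial μ b) = monomial μ (der i b) := by
        ext ν
        simp only [coeff_coeffDer, coeff_monomial]
        split_ifs <;> simp
      rw [h, X, monomial_mul, one_mul, map_add, ofSymbol_monomial, ofSymbol_monomial,
        ofSymbol_monomial, dpow_single_add, ← mul_assoc, ← mul_assoc, dop_mul_coeff, add_mul]
    | add f g hf hg =>
      rw [map_add (ofSymbol der) f g, mul_add (dop der i), ← hf, ← hg, ← map_add (ofSymbol der),
        map_add (coeffDer der i)]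
      congr 1
      ring
  | add P Q hP hQ => rw [map_add, LinearMap.add_apply, map_add, hP, hQ, add_mul]
  | mul P Q hP hQ => rw [rep_mul_apply, hP, hQ, mul_assoc]

/-- The symbol of an operator: `∑ a_μ x^μ` for `∑ a_μ d^μ`. -/
def symbol : DiffOp der →+ MvPolynomial (Fin n) K where
  toFun P := rep der hcomm P 1
  map_zero' := by simp
  map_add' P Q := by rw [map_add, LinearMap.add_apply]

theorem symbol_mul (P Q : DiffOp der) :
    symbol der hcomm (P * Q) = rep der hcomm P (symbol der hcomm Q) := by
  change rep der hcomm (P * Q) 1 = _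
  rw [rep_mul_apply]; rfl

theorem ofSymbol_symbol (P : DiffOp der) : ofSymbol der (symbol der hcomm P) = P := by
  refine (ofSymbol_rep der hcomm P 1).trans ?_
  have h : ofSymbol der 1 = 1 := by
    refine (ofSymbol_monomial der 0 1).trans ?_
    rw [map_one, one_mul]
    exact map_one (dpow der)
  rw [h, mul_one]

theorem symbol_injective : Function.Injective (symbol der hcomm) :=
  Function.LeftInverse.injective (ofSymbol_symbol der hcomm)

theorem symbol_ne_zero {P : DiffOp der} (hP : P ≠ 0) : symbol der hcomm P ≠ 0 :=
  (map_ne_zero_iff _ (symbol_injective der hcomm)).mpr hP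

theorem symbol_coeff (a : K) : symbol der hcomm (coeff der a) = C a := by
  refine (rep_coeff der hcomm a 1).trans (mul_one _)

theorem symbol_dop (i : Fin n) : symbol der hcomm (dop der i) = X i := by
  refine (rep_dop der hcomm i 1).trans ?_
  have h : coeffDer der i 1 = 0 := by
    ext μ
    rw [coeff_coeffDer, MvPolynomial.coeff_one]
    split_ifs <;> simp
  rw [h, mul_one, add_zero]

/-- The jets of order at most one are `K`-linearly independent. -/
theorem jetOp_linearIndependent (hcomm : ∀ i j a, der i (der j a) = der j (der i a))
    {c : Option (Fin n) → K}
    (h : ∑ j, coeff der (c j) * jetOp der j = 0) (j : Option (Fin n)) : c j = 0 := by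
  have h1 : C (c none) + ∑ i, C (c (some i)) * X i = (0 : MvPolynomial (Fin n) K) := by
    have := congrArg (symbol der hcomm) h
    simpa [Fintype.sum_option, jetOp, symbol_mul, rep_coeff, symbol_coeff, symbol_dop] using this
  cases j with
  | none => simpa [coeff_sum] using congrArg (MvPolynomial.coeff 0) h1
  | some i =>
    have h2 := congrArg (MvPolynomial.coeff (Finsupp.single i 1)) h1
    have h3 : (0 : Fin n →₀ ℕ) ≠ Finsupp.single i 1 := fun h => by
      simpa using DFunLike.congr_fun h i
    simpa [coeff_sum, MvPolynomial.coeff_X, coeff_C, h3, Finsupp.single_left_inj] using h2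

variable (mo : MonomialOrder (Fin n))

theorem degree_coeffDer_le (i : Fin n) (f : MvPolynomial (Fin n) K) :
    mo.degree (coeffDer der i f) ≼[mo] mo.degree f := by
  rw [MonomialOrder.degree_le_iff]
  intro μ hμ
  apply mo.le_degree
  rw [mem_support_iff] at hμ ⊢
  intro h
  rw [coeff_coeffDer, h, map_zero] at hμ
  exact hμ rfl

/-- Differentiating the coefficients never raises the degree, whereas multiplying by `X i` raises it
strictly. The leading term therefore behaves as in a commutative polynomial ring. -/
theorem degree_rep_dop (i : Fin n) {f : MvPolynomial (Fin n) K} (hf : f ≠ 0) :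
    mo.degree (rep der hcomm (dop der i) f) = Finsupp.single i 1 + mo.degree f ∧
      mo.leadingCoeff (rep der hcomm (dop der i) f) = mo.leadingCoeff f := by
  have hX : mo.degree (X i * f) = Finsupp.single i 1 + mo.degree f := by
    rw [mo.degree_mul (X_ne_zero i) hf, mo.degree_X]
  have h : mo.degree (coeffDer der i f) ≺[mo] mo.degree (X i * f) := by
    refine (degree_coeffDer_le der mo i f).trans_lt ?_
    rw [hX, map_add, lt_add_iff_pos_left, mo.toSyn_lt_iff_ne_zero]
    simp
  rw [rep_dop, mo.degree_add_of_lt h, mo.leadingCoeff_add_of_lt h, mo.leadingCoeff_mul,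
    mo.leadingCoeff_X, one_mul]
  exact ⟨hX, rfl⟩

theorem degree_rep_dpow (μ : Fin n →₀ ℕ) {f : MvPolynomial (Fin n) K} (hf : f ≠ 0) :
    mo.degree (rep der hcomm (dpow der fun i => .ofAdd (μ i)) f) = μ + mo.degree f ∧
      mo.leadingCoeff (rep der hcomm (dpow der fun i => .ofAdd (μ i)) f) = mo.leadingCoeff f := by
  have key : ∀ k : ℕ, ∀ μ : Fin n →₀ ℕ, μ.degree = k →
      mo.degree (rep der hcomm (dpow der fun i => .ofAdd (μ i)) f) = μ + mo.degree f ∧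
      mo.leadingCoeff (rep der hcomm (dpow der fun i => .ofAdd (μ i)) f) =
        mo.leadingCoeff f := by
    intro k
    induction k with
    | zero =>
      intro μ hμ
      rw [Finsupp.degree_eq_zero_iff] at hμ
      subst hμ
      have h : (dpow der fun i => .ofAdd ((0 : Fin n →₀ ℕ) i)) = 1 := map_one (dpow der)
      rw [h, map_one, zero_add]
      exact ⟨rfl, rfl⟩
    | succ k ih =>
      intro μ hμ
      obtain ⟨i, hi⟩ : ∃ i, μ i ≠ 0 := by
        by_contra! h
        have : μ = 0 := by ext i; simp [h i]
        simp [this] at hμ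
      obtain ⟨ν, rfl⟩ : ∃ ν, μ = Finsupp.single i 1 + ν :=
        exists_add_of_le (by simpa [Nat.one_le_iff_ne_zero] using hi)
      have hν := ih ν (by rw [map_add, Finsupp.degree_single] at hμ; omega)
      have h0 : rep der hcomm (dpow der fun i => .ofAdd (ν i)) f ≠ 0 := by
        rw [← mo.leadingCoeff_ne_zero_iff, hν.2, mo.leadingCoeff_ne_zero_iff]
        exact hf
      have h := degree_rep_dop der hcomm mo i h0
      rw [dpow_single_add, rep_mul_apply, h.1, h.2, hν.1, hν.2, add_assoc]
      exact ⟨rfl, rfl⟩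
  exact key _ μ rfl

theorem symbol_mul_eq_sum (P Q : DiffOp der) :
    symbol der hcomm (P * Q) = ∑ μ ∈ (symbol der hcomm P).support,
      C (MvPolynomial.coeff μ (symbol der hcomm P)) *
        rep der hcomm (dpow der fun i => .ofAdd (μ i)) (symbol der hcomm Q) := by
  conv_lhs => rw [symbol_mul, ← ofSymbol_symbol der hcomm P]
  conv_lhs => rw [(symbol der hcomm P).as_sum]
  rw [map_sum, map_sum, LinearMap.sum_apply]
  refine Finset.sum_congr rfl fun μ _ => ?_
  rw [ofSymbol_monomial, rep_mul_apply, rep_coeff]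

/-- The leading exponents of operators add up. -/
theorem degree_symbol_mul {P Q : DiffOp der} (hP : P ≠ 0) (hQ : Q ≠ 0) :
    P * Q ≠ 0 ∧ mo.degree (symbol der hcomm (P * Q)) =
      mo.degree (symbol der hcomm P) + mo.degree (symbol der hcomm Q) := by
  set g := symbol der hcomm P with hg
  set f := symbol der hcomm Q with hf
  have hg0 : g ≠ 0 := symbol_ne_zero der hcomm hP
  have hf0 : f ≠ 0 := symbol_ne_zero der hcomm hQ
  have hsum := symbol_mul_eq_sum der hcomm P Q
  rw [← hg, ← hf] at hsum
  have hzero : ∀ μ ν, μ + mo.degree f ≺[mo] ν → MvPolynomial.coeff ν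
      (rep der hcomm (dpow der fun i => .ofAdd (μ i)) f) = 0 := fun μ ν h =>
    mo.coeff_eq_zero_of_lt (by rwa [(degree_rep_dpow der hcomm mo μ hf0).1])
  -- Only the leading monomial of `P` reaches this exponent, so nothing can cancel its contribution.
  have htop : MvPolynomial.coeff (mo.degree g + mo.degree f) (symbol der hcomm (P * Q)) ≠ 0 := by
    rw [hsum, coeff_sum, Finset.sum_eq_single (mo.degree g)]
    · have h := degree_rep_dpow der hcomm mo (mo.degree g) hf0
      rw [coeff_C_mul, ← h.1]
      refine mul_ne_zero (mo.coeff_degree_ne_zero_iff.mpr hg0) ?_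
      exact h.2.trans_ne (mo.leadingCoeff_ne_zero_iff.mpr hf0)
    · intro μ hμ hne
      rw [coeff_C_mul, hzero, mul_zero]
      rw [map_add, map_add]
      exact add_lt_add_left (lt_of_le_of_ne (mo.le_degree hμ)
        fun h => hne (mo.toSyn.injective h)) _
    · exact fun h => absurd (mo.degree_mem_support hg0) h
  refine ⟨fun h => htop (by simp [h]), mo.toSyn.injective (le_antisymm ?_ ?_)⟩
  · rw [MonomialOrder.degree_le_iff]
    intro ν hν
    by_contra! hlt
    rw [mem_support_iff] at hν
    apply hν
    rw [hsum, coeff_sum]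
    refine Finset.sum_eq_zero fun μ hμ => ?_
    rw [coeff_C_mul, hzero, mul_zero]
    refine lt_of_le_of_lt ?_ hlt
    rw [map_add, map_add]
    exact add_le_add_left (mo.le_degree hμ) _
  · exact mo.le_degree (mem_support_iff.mpr htop)

end Operators

/-! ### The degree in `d_n` -/

section TopDegree

/-- The lexicographic monomial order for which the last variable is the greatest one. -/
def lastLex (n : ℕ) : MonomialOrder (Fin n) :=
  (MonomialOrder.lex : MonomialOrder (Fin n)ᵒᵈ)

theorem apply_last_le_of_lastLex_le {n : ℕ} {μ ν : Fin (n + 1) →₀ ℕ}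
    (h : μ ≼[lastLex (n + 1)] ν) : μ (Fin.last n) ≤ ν (Fin.last n) := by
  by_contra! hlt
  refine h.not_gt ?_
  -- In the dual order the last variable comes first, so its exponent decides the comparison and the
  -- condition on earlier indices is vacuous.
  refine Finsupp.Lex.lt_iff.mpr ⟨OrderDual.toDual (Fin.last n), fun j hj => ?_, hlt⟩
  exact absurd (OrderDual.lt_toDual.mp hj) (Fin.le_last _).not_gt

variable {K : Type*} [Field K] {n : ℕ} (der : Fin (n + 1) → Derivation ℤ K K)
  (hcomm : ∀ i j a, der i (der j a) = der j (der i a))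

/-- The degree of an operator in `d_n`, with the value `0` for the operator `0`. -/
def topDegree (P : DiffOp der) : ℕ :=
  (lastLex (n + 1)).degree (symbol der hcomm P) (Fin.last n)

theorem topDegree_zero : topDegree der hcomm 0 = 0 := by
  simp [topDegree]

/-- Both factors must be nonzero because the operator `0` has degree `0` here, not `-∞`; only the
inequality `topDegree_mul_le` holds without restriction. -/
theorem topDegree_mul {P Q : DiffOp der} (hP : P ≠ 0) (hQ : Q ≠ 0) :
    topDegree der hcomm (P * Q) = topDegree der hcomm P + topDegree der hcomm Q := by
  rw [topDegree, (degree_symbol_mul der hcomm (lastLex (n + 1)) hP hQ).2]; rfl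

theorem diffOp_mul_ne_zero (hcomm : ∀ i j a, der i (der j a) = der j (der i a))
    {P Q : DiffOp der} (hP : P ≠ 0) (hQ : Q ≠ 0) : P * Q ≠ 0 :=
  (degree_symbol_mul der hcomm (lastLex (n + 1)) hP hQ).1

theorem topDegree_mul_le (P Q : DiffOp der) :
    topDegree der hcomm (P * Q) ≤ topDegree der hcomm P + topDegree der hcomm Q := by
  by_cases hP : P = 0
  · simp [hP, topDegree_zero]
  by_cases hQ : Q = 0
  · simp [hQ, topDegree_zero]
  exact (topDegree_mul der hcomm hP hQ).le

theorem topDegree_add_le {P Q : DiffOp der} {r : ℕ} (hP : topDegree der hcomm P ≤ r)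
    (hQ : topDegree der hcomm Q ≤ r) : topDegree der hcomm (P + Q) ≤ r := by
  have h := (lastLex (n + 1)).degree_add_le (f := symbol der hcomm P) (g := symbol der hcomm Q)
  rw [← map_add, le_max_iff] at h
  rcases h with h | h
  · exact (apply_last_le_of_lastLex_le h).trans hP
  · exact (apply_last_le_of_lastLex_le h).trans hQ

theorem topDegree_neg (P : DiffOp der) : topDegree der hcomm (-P) = topDegree der hcomm P := by
  rw [topDegree, map_neg, MonomialOrder.degree_neg]; rfl

theorem topDegree_sub_le {P Q : DiffOp der} {r : ℕ} (hP : topDegree der hcomm P ≤ r)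
    (hQ : topDegree der hcomm Q ≤ r) : topDegree der hcomm (P - Q) ≤ r := by
  rw [sub_eq_add_neg]
  exact topDegree_add_le der hcomm hP ((topDegree_neg der hcomm Q).trans_le hQ)

theorem topDegree_sum_le {ι : Type*} (s : Finset ι) (f : ι → DiffOp der) {r : ℕ}
    (h : ∀ i ∈ s, topDegree der hcomm (f i) ≤ r) : topDegree der hcomm (∑ i ∈ s, f i) ≤ r :=
  Finset.sum_induction f (fun P => topDegree der hcomm P ≤ r)
    (fun _ _ => topDegree_add_le der hcomm) (by simp [topDegree_zero]) h

theorem topDegree_coeff (a : K) : topDegree der hcomm (coeff der a) = 0 := by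
  simp [topDegree, symbol_coeff]

theorem topDegree_dop (i : Fin (n + 1)) :
    topDegree der hcomm (dop der i) = if i = Fin.last n then 1 else 0 := by
  rw [topDegree, symbol_dop, MonomialOrder.degree_X, Finsupp.single_apply]

theorem dop_ne_zero (hcomm : ∀ i j a, der i (der j a) = der j (der i a)) (i : Fin (n + 1)) :
    dop der i ≠ 0 := fun h =>
  X_ne_zero (R := K) i (by rw [← symbol_dop der hcomm i, h, map_zero])

theorem topDegree_eq_zero_of_mem {P : DiffOp der} (hP : P ∈ lowerOps der) :
    topDegree der hcomm P = 0 := by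
  rw [← Nat.le_zero]
  induction hP using Subring.closure_induction with
  | mem P hP =>
    rcases hP with ⟨a, rfl⟩ | ⟨i, hi, rfl⟩
    · exact (topDegree_coeff der hcomm a).le
    · rw [topDegree_dop, if_neg hi]
  | zero => exact (topDegree_zero der hcomm).le
  | one =>
    rw [← map_one (coeff der)]
    exact (topDegree_coeff der hcomm 1).le
  | add P Q _ _ hP hQ => exact topDegree_add_le der hcomm hP hQ
  | neg P _ hP => rwa [topDegree_neg]
  | mul P Q _ _ hP hQ => exact (topDegree_mul_le der hcomm P Q).trans (by omega)

end TopDegree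

/-! ### Consequences of involution -/

section LowerOps

variable {K : Type*} [Field K] {n m p : ℕ} (der : Fin (n + 1) → Derivation ℤ K K)

theorem coeff_mem_lowerOps (a : K) : coeff der a ∈ lowerOps der :=
  Subring.subset_closure (Or.inl ⟨a, rfl⟩)

theorem dop_mem_lowerOps {i : Fin (n + 1)} (hi : i ≠ Fin.last n) : dop der i ∈ lowerOps der :=
  Subring.subset_closure (Or.inr ⟨i, hi, rfl⟩)

/-- The commutator with `d_j` is a derivation that sends the generators of the subring into it. It
allows `d_n` to be moved past coefficients at the cost of lower terms only. -/
theorem commutator_mem_lowerOps (j : Fin (n + 1)) {P : DiffOp der} (hP : P ∈ lowerOps der) :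
    dop der j * P - P * dop der j ∈ lowerOps der := by
  induction hP using Subring.closure_induction with
  | mem P hP =>
    rcases hP with ⟨a, rfl⟩ | ⟨i, hi, rfl⟩
    · rw [dop_mul_coeff, add_sub_cancel_left]
      exact coeff_mem_lowerOps der _
    · rw [(commute_dop der j i).eq, sub_self]
      exact zero_mem _
  | zero => simp
  | one => simp
  | add P Q _ _ hP hQ =>
    convert! add_mem hP hQ using 1
    noncomm_ring
  | neg P _ hP =>
    convert! neg_mem hP using 1
    noncomm_ring
  | mul P Q hP' hQ' hP hQ =>
    convert! add_mem (mul_mem hP hQ') (mul_mem hP' hQ) using 1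
    noncomm_ring

/-- An additive submonoid of a `D`-module stable under `K[d_1, …, d_{n-1}]` and under `d_n` is
stable under `D`. -/
theorem smul_mem_of_lowerOps {M : Type*} [AddCommGroup M] [Module (DiffOp der) M]
    (N : AddSubmonoid M) (hlow : ∀ P ∈ lowerOps der, ∀ v ∈ N, P • v ∈ N)
    (hlast : ∀ v ∈ N, dop der (Fin.last n) • v ∈ N) (P : DiffOp der) {v : M} (hv : v ∈ N) :
    P • v ∈ N := by
  induction P using DiffOp.induction generalizing v with
  | coeff' a => exact hlow _ (coeff_mem_lowerOps der a) v hv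
  | dop' i =>
    by_cases hi : i = Fin.last n
    · subst hi; exact hlast v hv
    · exact hlow _ (dop_mem_lowerOps der hi) v hv
  | add P Q hP hQ => rw [add_smul]; exact add_mem (hP hv) (hQ hv)
  | mul P Q hP hQ => rw [mul_smul]; exact hP (hQ hv)

/-- The combinations of the equations where those of class less than `n` only have coefficients
in `K[d_1, …, d_{n-1}]`. -/
def restrictedCombinations (Φ : Fin p → Jet1 K (n + 1) m) (cls : Fin p → Fin (n + 1)) :
    AddSubmonoid (Fin m → DiffOp der) where
  carrier := {v | ∃ R : Fin p → DiffOp der, (∀ τ, cls τ ≠ Fin.last n → R τ ∈ lowerOps der) ∧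
    v = ∑ τ, R τ • lhs der (Φ τ)}
  zero_mem' := ⟨0, fun _ _ => zero_mem _, by simp⟩
  add_mem' := by
    rintro _ _ ⟨R, hR, rfl⟩ ⟨S, hS, rfl⟩
    exact ⟨R + S, fun τ h => add_mem (hR τ h) (hS τ h), by
      simp [add_smul, Finset.sum_add_distrib]⟩

variable {der} {Φ : Fin p → Jet1 K (n + 1) m} {cls : Fin p → Fin (n + 1)}

theorem smul_lhs_mem_restrictedCombinations (τ : Fin p) {R : DiffOp der}
    (hR : cls τ ≠ Fin.last n → R ∈ lowerOps der) :
    R • lhs der (Φ τ) ∈ restrictedCombinations der Φ cls := by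
  refine ⟨Pi.single τ R, fun σ hσ => ?_, ?_⟩
  · by_cases h : σ = τ
    · subst h; simpa using hR hσ
    · rw [Pi.single_eq_of_ne h]; exact zero_mem _
  · rw [Finset.sum_eq_single τ] <;> simp +contextual

theorem lower_smul_mem_restrictedCombinations {P : DiffOp der} (hP : P ∈ lowerOps der)
    {v : Fin m → DiffOp der} (hv : v ∈ restrictedCombinations der Φ cls) :
    P • v ∈ restrictedCombinations der Φ cls := by
  obtain ⟨R, hR, rfl⟩ := hv
  exact ⟨fun τ => P * R τ, fun τ h => mul_mem hP (hR τ h), by simp [Finset.smul_sum, mul_smul]⟩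

/-- Since `d_n` is multiplicative only for equations of class `n`, the multipliers that involution
allows for lower classes already lie in `K[d_1, …, d_{n-1}]`. -/
theorem prolongation_mem_restrictedCombinations (hinv : IsInvolutive der Φ cls) (τ : Fin p)
    (j : Fin (n + 1)) : dop der j • lhs der (Φ τ) ∈ restrictedCombinations der Φ cls := by
  have h := hinv τ j
  generalize dop der j • lhs der (Φ τ) = w at h
  induction h using Submodule.span_induction with
  | mem v hv =>
    rcases hv with ⟨σ, rfl⟩ | ⟨σ, i, hi, rfl⟩
    · rw [← one_smul (DiffOp der) (lhs der (Φ σ))]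
      exact smul_lhs_mem_restrictedCombinations σ fun _ => one_mem _
    · refine smul_lhs_mem_restrictedCombinations σ fun hσ => dop_mem_lowerOps der ?_
      exact (hi.trans_lt (lt_of_le_of_ne (Fin.le_last _) hσ)).ne
  | zero => exact zero_mem _
  | add v w _ _ hv hw => exact add_mem hv hw
  | smul a v _ hv => exact lower_smul_mem_restrictedCombinations (coeff_mem_lowerOps der a) hv

/-- For an involutive system, the equations of class less than `n` only need coefficients in
`K[d_1, …, d_{n-1}]`. -/
theorem eqModule_le_restrictedCombinations (hinv : IsInvolutive der Φ cls)
    {v : Fin m → DiffOp der} (hv : v ∈ eqModule der Φ) :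
    v ∈ restrictedCombinations der Φ cls := by
  induction hv using Submodule.span_induction with
  | mem v hv =>
    obtain ⟨τ, rfl⟩ := hv
    have h := smul_lhs_mem_restrictedCombinations (Φ := Φ) (cls := cls) τ (R := 1)
      fun _ => one_mem (lowerOps der)
    rwa [one_smul] at h
  | zero => exact zero_mem _
  | add v w _ _ hv hw => exact add_mem hv hw
  | smul P v _ hv =>
    refine smul_mem_of_lowerOps der _
      (fun P hP v hv => lower_smul_mem_restrictedCombinations hP hv) ?_ P hv
    rintro _ ⟨R, hR, rfl⟩
    rw [Finset.smul_sum]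
    refine sum_mem fun τ _ => ?_
    by_cases hτ : cls τ = Fin.last n
    · rw [← mul_smul]
      exact smul_lhs_mem_restrictedCombinations τ fun h => absurd hτ h
    · have h : dop der (Fin.last n) • R τ • lhs der (Φ τ) =
          R τ • dop der (Fin.last n) • lhs der (Φ τ) +
            (dop der (Fin.last n) * R τ - R τ * dop der (Fin.last n)) • lhs der (Φ τ) := by
        rw [sub_smul, mul_smul, mul_smul]; abel
      rw [h]
      exact add_mem (lower_smul_mem_restrictedCombinations (hR τ hτ)
        (prolongation_mem_restrictedCombinations hinv τ _))
        (smul_lhs_mem_restrictedCombinations τ fun hτ =>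
          commutator_mem_lowerOps der _ (hR τ hτ))

end LowerOps

/-! ### The change of unknowns -/

section Coordinates

variable {K : Type*} [Field K] {n m p : ℕ}

/-- The coefficient operator of the `k`-th unknown in a first order expression. -/
def row (der : Fin n → Derivation ℤ K K) (φ : Jet1 K n m) (k : Fin m) : DiffOp der :=
  ∑ j, coeff der (φ j k) * jetOp der j

theorem subst_eq_sum_row (der : Fin n → Derivation ℤ K K) (u : Fin m → Fin m → DiffOp der)
    (φ : Jet1 K n m) : subst der u φ = ∑ k, row der φ k • u k := by
  rw [subst, Finset.sum_comm]
  refine Finset.sum_congr rfl fun k _ => ?_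
  rw [row, Finset.sum_smul]
  refine Finset.sum_congr rfl fun j _ => ?_
  rw [mul_smul]; rfl

theorem row_injective {der : Fin n → Derivation ℤ K K}
    (hcomm : ∀ i j a, der i (der j a) = der j (der i a)) {φ ψ : Jet1 K n m} {k : Fin m}
    (h : row der φ k = row der ψ k) (j : Option (Fin n)) : φ j k = ψ j k := by
  refine sub_eq_zero.mp (jetOp_linearIndependent der hcomm (c := fun j => φ j k - ψ j k) ?_ j)
  simp only [map_sub, sub_mul, Finset.sum_sub_distrib]
  exact sub_eq_zero.mpr h

theorem row_mul_coeff (der : Fin n → Derivation ℤ K K) (φ : Jet1 K n m) (k : Fin m) (a : K) :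
    row der φ k * coeff der a = coeff der (φ none k * a + ∑ i, φ (some i) k * der i a) +
      ∑ i, coeff der (φ (some i) k * a) * dop der i := by
  simp only [row, Fintype.sum_option, jetOp, add_mul, Finset.sum_mul, mul_assoc, dop_mul_coeff,
    mul_add, Finset.sum_add_distrib, map_add, map_sum, map_mul, mul_one]
  abel

theorem row_sub_mem_lowerOps (der : Fin (n + 1) → Derivation ℤ K K) (φ : Jet1 K (n + 1) m)
    (k : Fin m) : row der φ k - coeff der (φ (some (Fin.last n)) k) * dop der (Fin.last n) ∈
      lowerOps der := by
  rw [row, Fintype.sum_option, Fin.sum_univ_castSucc, ← add_assoc]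
  simp only [jetOp, add_sub_cancel_right, mul_one]
  exact add_mem (coeff_mem_lowerOps der _) (sum_mem fun i _ =>
    mul_mem (coeff_mem_lowerOps der _) (dop_mem_lowerOps der (Fin.castSucc_lt_last i).ne))

/-- The matrix of the change of unknowns `ȳ^k = y^k + ∑ b^k_l y^l`. -/
def shift (Φ : Fin p → Jet1 K (n + 1) m) (cls : Fin p → Fin (n + 1)) (lead : Fin p → Fin m)
    (β : ℕ) (k l : Fin m) : K :=
  if β ≤ l.val then ∑ τ with cls τ = Fin.last n ∧ lead τ = k, Φ τ (some (Fin.last n)) l else 0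

/-- A first order expression rewritten with the new unknowns. -/
def rewriteJet (der : Fin n → Derivation ℤ K K) (b : Fin m → Fin m → K) (φ : Jet1 K n m) :
    Jet1 K n m
  | none, l => φ none l - ∑ k, (φ none k * b k l + ∑ i, φ (some i) k * der i (b k l))
  | some i, l => φ (some i) l - ∑ k, φ (some i) k * b k l

theorem row_rewriteJet (der : Fin n → Derivation ℤ K K) (b : Fin m → Fin m → K)
    (φ : Jet1 K n m) (l : Fin m) :
    row der (rewriteJet der b φ) l = row der φ l - ∑ k, row der φ k * coeff der (b k l) := by
  simp only [row_mul_coeff]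
  simp only [row, Fintype.sum_option, jetOp, rewriteJet, map_sub, sub_mul, map_sum, mul_one,
    map_add, Finset.sum_add_distrib, Finset.sum_sub_distrib, Finset.sum_mul]
  rw [Finset.sum_comm (s := Finset.univ (α := Fin m)) (t := Finset.univ (α := Fin n))
    (f := fun k i => coeff der (φ (some i) k * b k l) * dop der i)]
  abel

variable (der : Fin (n + 1) → Derivation ℤ K K) {Φ : Fin p → Jet1 K (n + 1) m}
  {cls : Fin p → Fin (n + 1)} {lead : Fin p → Fin m} {β : ℕ}

theorem ybar_eq (k : Fin m) : ybar der Φ cls lead β k =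
    unk der m k + ∑ l, coeff der (shift Φ cls lead β k l) • unk der m l := by
  rw [ybar, Finset.sum_comm, Finset.sum_filter]
  congr 1
  refine Finset.sum_congr rfl fun l _ => ?_
  rw [shift]
  split_ifs
  · rw [map_sum, Finset.sum_smul]; rfl
  · simp

theorem shift_eq_zero_of_lt {k l : Fin m} (hl : l.val < β) : shift Φ cls lead β k l = 0 :=
  if_neg hl.not_ge

theorem IsSolved.lead_injOn (hsolved : IsSolved Φ cls lead) {τ σ : Fin p}
    (hcls : cls τ = cls σ) (h : lead τ = lead σ) : τ = σ := by
  by_contra hne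
  have h1 := hsolved.solved τ σ hcls
  rw [if_neg hne, ← h, ← hcls, hsolved.solved τ τ rfl, if_pos rfl] at h1
  exact one_ne_zero h1

theorem shift_lead (hsolved : IsSolved Φ cls lead) {τ : Fin p} (hτ : cls τ = Fin.last n)
    {l : Fin m} (hl : β ≤ l.val) :
    shift Φ cls lead β (lead τ) l = Φ τ (some (Fin.last n)) l := by
  rw [shift, if_pos hl]
  have h : ({σ | cls σ = Fin.last n ∧ lead σ = lead τ} : Finset (Fin p)) = {τ} := by
    ext σ
    simp only [Finset.mem_filter, Finset.mem_univ, true_and, Finset.mem_singleton]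
    exact ⟨fun h => hsolved.lead_injOn (h.1.trans hτ.symm) h.2, by rintro rfl; exact ⟨hτ, rfl⟩⟩
  rw [h, Finset.sum_singleton]

theorem shift_eq_zero_of_le
    (hlead : ∀ k : Fin m, (∃ τ, cls τ = Fin.last n ∧ lead τ = k) ↔ k.val < β)
    {k l : Fin m} (hk : β ≤ k.val) : shift Φ cls lead β k l = 0 := by
  rw [shift]
  split_ifs
  · refine Finset.sum_eq_zero fun τ hτ => ?_
    exact absurd ((hlead k).mp ⟨τ, (Finset.mem_filter.mp hτ).2⟩) hk.not_gt
  · rfl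

/-- The matrix `b` only sends leading unknowns to inputs, so `b² = 0` and the inverse of `1 + b` is
`1 - b`. -/
theorem shift_mul_shift
    (hlead : ∀ k : Fin m, (∃ τ, cls τ = Fin.last n ∧ lead τ = k) ↔ k.val < β)
    (k l r : Fin m) : shift Φ cls lead β k l * shift Φ cls lead β l r = 0 := by
  rcases lt_or_ge l.val β with h | h
  · rw [shift_eq_zero_of_lt h, zero_mul]
  · rw [shift_eq_zero_of_le hlead h, mul_zero]

theorem unk_eq_ybar
    (hlead : ∀ k : Fin m, (∃ τ, cls τ = Fin.last n ∧ lead τ = k) ↔ k.val < β) (k : Fin m) :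
    unk der m k = ybar der Φ cls lead β k -
      ∑ l, coeff der (shift Φ cls lead β k l) • ybar der Φ cls lead β l := by
  have h : ∀ l, coeff der (shift Φ cls lead β k l) • ybar der Φ cls lead β l =
      coeff der (shift Φ cls lead β k l) • unk der m l := fun l => by
    rw [ybar_eq, smul_add, Finset.smul_sum, add_eq_left]
    refine Finset.sum_eq_zero fun r _ => ?_
    rw [← mul_smul, ← map_mul, shift_mul_shift hlead, map_zero, zero_smul]
  simp only [h]
  rw [ybar_eq, add_sub_cancel_right]

theorem sum_smul_unk (V : Fin m → DiffOp der) : ∑ k, V k • unk der m k = V := by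
  funext j
  simp [Finset.sum_apply, unk, Pi.single_apply]

/-- The change of unknowns is triangular: coordinates of index below `β` are unaffected, and they
alone determine the corrections to the others. -/
theorem sum_smul_ybar_injective
    (hlead : ∀ k : Fin m, (∃ τ, cls τ = Fin.last n ∧ lead τ = k) ↔ k.val < β)
    {V W : Fin m → DiffOp der}
    (h : ∑ k, V k • ybar der Φ cls lead β k = ∑ k, W k • ybar der Φ cls lead β k) : V = W := by
  have hcoord : ∀ (V : Fin m → DiffOp der) j, (∑ k, V k • ybar der Φ cls lead β k) j =
      V j + ∑ k, V k * coeff der (shift Φ cls lead β k j) := by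
    intro V j
    simp only [ybar_eq, smul_add, Finset.sum_add_distrib, sum_smul_unk, Pi.add_apply]
    rw [Finset.sum_apply]
    congr 1
  have hlow : ∀ k : Fin m, k.val < β → V k = W k := fun k hk => by
    simpa [hcoord, shift_eq_zero_of_lt hk] using congrFun h k
  funext j
  have hj := congrFun h j
  rw [hcoord, hcoord] at hj
  have hsum : ∑ k, V k * coeff der (shift Φ cls lead β k j) =
      ∑ k, W k * coeff der (shift Φ cls lead β k j) := by
    refine Finset.sum_congr rfl fun k _ => ?_
    rcases lt_or_ge k.val β with hk | hk
    · rw [hlow k hk]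
    · rw [shift_eq_zero_of_le hlead hk, map_zero, mul_zero, mul_zero]
  rw [hsum] at hj
  exact add_right_cancel hj

theorem lhs_eq_sum_ybar
    (hlead : ∀ k : Fin m, (∃ τ, cls τ = Fin.last n ∧ lead τ = k) ↔ k.val < β)
    (φ : Jet1 K (n + 1) m) : lhs der φ =
      ∑ l, row der (rewriteJet der (shift Φ cls lead β) φ) l • ybar der Φ cls lead β l := by
  rw [lhs, subst_eq_sum_row]
  simp only [row_rewriteJet, unk_eq_ybar (Φ := Φ) der hlead, sub_smul, smul_sub, Finset.sum_sub_distrib,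
    Finset.smul_sum, Finset.sum_smul, mul_smul]
  rw [Finset.sum_comm (f := fun k l => row der φ k • coeff der (shift Φ cls lead β k l) •
    ybar der Φ cls lead β l)]

/-- Among the leading jets of class `n`, the equation contains only its own, with coefficient `1`.
Substituting for that one unknown produces exactly the terms that cancel the inputs of class `n`. -/
theorem rewriteJet_class_top (hsolved : IsSolved Φ cls lead)
    (hlead : ∀ k : Fin m, (∃ τ, cls τ = Fin.last n ∧ lead τ = k) ↔ k.val < β)
    {τ : Fin p} (hτ : cls τ = Fin.last n) :
    (∀ k : Fin m, k.val < β → rewriteJet der (shift Φ cls lead β) (Φ τ) (some (Fin.last n)) k =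
      if k = lead τ then 1 else 0) ∧
    (∀ l : Fin m, β ≤ l.val →
      rewriteJet der (shift Φ cls lead β) (Φ τ) (some (Fin.last n)) l = 0) := by
  have hΦ : ∀ k : Fin m, k.val < β → Φ τ (some (Fin.last n)) k = if k = lead τ then 1 else 0 := by
    intro k hk
    obtain ⟨σ, hσ, rfl⟩ := (hlead k).mpr hk
    have h := hsolved.solved τ σ (hτ.trans hσ.symm)
    rw [hσ] at h
    rw [h]
    refine if_congr ⟨fun h => h ▸ rfl, fun h => ?_⟩ rfl rfl
    exact hsolved.lead_injOn (hτ.trans hσ.symm) h.symm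
  refine ⟨fun k hk => ?_, fun l hl => ?_⟩
  · rw [rewriteJet, Finset.sum_eq_zero, sub_zero, hΦ k hk]
    intro r _
    rw [shift_eq_zero_of_lt hk, mul_zero]
  · rw [rewriteJet, Finset.sum_eq_single (lead τ), shift_lead hsolved hτ hl,
      hΦ _ ((hlead _).mp ⟨τ, hτ, rfl⟩), if_pos rfl, one_mul, sub_self]
    · intro k _ hne
      rcases lt_or_ge k.val β with hk | hk
      · rw [hΦ k hk, if_neg hne, zero_mul]
      · rw [shift_eq_zero_of_le hlead hk, mul_zero]
    · simp

theorem rewriteJet_eq_zero_of_lt (hsolved : IsSolved Φ cls lead) (b : Fin m → Fin m → K)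
    {τ : Fin p} {i : Fin (n + 1)} (hi : cls τ < i) (k : Fin m) :
    rewriteJet der b (Φ τ) (some i) k = 0 := by
  simp [rewriteJet, hsolved.no_higher τ i _ hi]

end Coordinates

/-! ### Comparison of degrees in `d_n` and torsion -/

section Torsion

variable {K : Type*} [Field K] {n m p : ℕ} {der : Fin (n + 1) → Derivation ℤ K K}
  {Φ : Fin p → Jet1 K (n + 1) m} {cls : Fin p → Fin (n + 1)} {lead : Fin p → Fin m} {β : ℕ}

/-- The rows of the rewritten equations: up to terms in `K[d_1, …, d_{n-1}]`, only the leading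
unknown of an equation of class `n` has the coefficient `d_n`. -/
theorem row_rewriteJet_sub_mem_lowerOps (hsolved : IsSolved Φ cls lead)
    (hlead : ∀ k : Fin m, (∃ τ, cls τ = Fin.last n ∧ lead τ = k) ↔ k.val < β)
    (τ : Fin p) (k : Fin m) :
    row der (rewriteJet der (shift Φ cls lead β) (Φ τ)) k -
      (if cls τ = Fin.last n ∧ k = lead τ then dop der (Fin.last n) else 0) ∈ lowerOps der := by
  convert! row_sub_mem_lowerOps der (rewriteJet der (shift Φ cls lead β) (Φ τ)) k using 2
  by_cases hτ : cls τ = Fin.last n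
  · obtain ⟨h1, h2⟩ := rewriteJet_class_top der hsolved hlead hτ
    rcases lt_or_ge k.val β with hk | hk
    · rw [h1 k hk]; by_cases h : k = lead τ <;> simp [h, hτ]
    · have hne : k ≠ lead τ := fun h => hk.not_gt (h ▸ (hlead _).mp ⟨τ, hτ, rfl⟩)
      simp [h2 k hk, hne]
  · rw [rewriteJet_eq_zero_of_lt der hsolved _ (lt_of_le_of_ne (Fin.le_last _) hτ)]
    simp [hτ]

theorem row_rewriteJet_mem_lowerOps (hsolved : IsSolved Φ cls lead)
    (hlead : ∀ k : Fin m, (∃ τ, cls τ = Fin.last n ∧ lead τ = k) ↔ k.val < β)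
    (τ : Fin p) {l : Fin m} (hl : β ≤ l.val) :
    row der (rewriteJet der (shift Φ cls lead β) (Φ τ)) l ∈ lowerOps der := by
  have h := row_rewriteJet_sub_mem_lowerOps (der := der) hsolved hlead τ l
  have hne : ¬ (cls τ = Fin.last n ∧ l = lead τ) := fun hτ =>
    hl.not_gt ((hlead l).mp ⟨τ, hτ.1, hτ.2.symm⟩)
  rwa [if_neg hne, sub_zero] at h

/-- In a restricted combination of the equations whose first `β` coordinates have degree at most
`r` in `d_n`, the coefficients of the equations of class `n` have degree less than `r`. -/
theorem coefficient_topDegree_lt (hcomm : ∀ i j a, der i (der j a) = der j (der i a))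
    (hsolved : IsSolved Φ cls lead)
    (hlead : ∀ k : Fin m, (∃ τ, cls τ = Fin.last n ∧ lead τ = k) ↔ k.val < β)
    {R : Fin p → DiffOp der} (hR : ∀ τ, cls τ ≠ Fin.last n → R τ ∈ lowerOps der) {r : ℕ}
    (hr : ∀ k : Fin m, k.val < β → topDegree der hcomm
      (∑ τ, R τ * row der (rewriteJet der (shift Φ cls lead β) (Φ τ)) k) ≤ r)
    {σ : Fin p} (hσ : cls σ = Fin.last n) (hRσ : R σ ≠ 0) :
    topDegree der hcomm (R σ) < r := by
  classical
  -- Along the leading unknown of a coefficient of greatest degree, `R ρ * d_n` has degree one more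
  -- than `R ρ`, and no other term can compensate for it.
  obtain ⟨ρ, hρ, hmax⟩ := Finset.exists_max_image
    (Finset.univ.filter fun τ => cls τ = Fin.last n ∧ R τ ≠ 0)
    (fun τ => topDegree der hcomm (R τ)) ⟨σ, by simp [hσ, hRσ]⟩
  simp only [Finset.mem_filter, Finset.mem_univ, true_and] at hρ hmax
  refine (hmax σ ⟨hσ, hRσ⟩).trans_lt ?_
  by_contra! hle
  set k := lead ρ
  set A : Fin p → DiffOp der := fun τ =>
    row der (rewriteJet der (shift Φ cls lead β) (Φ τ)) k -
      (if cls τ = Fin.last n ∧ k = lead τ then dop der (Fin.last n) else 0) with hA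
  have hA0 : ∀ τ, topDegree der hcomm (A τ) = 0 := fun τ =>
    topDegree_eq_zero_of_mem der hcomm (row_rewriteJet_sub_mem_lowerOps hsolved hlead τ k)
  have hsum : R ρ * dop der (Fin.last n) =
      ∑ τ, R τ * row der (rewriteJet der (shift Φ cls lead β) (Φ τ)) k - ∑ τ, R τ * A τ := by
    rw [← Finset.sum_sub_distrib, Finset.sum_eq_single ρ]
    · simp [hA, k, hρ.1, mul_sub]
    · intro τ _ hne
      have : ¬ (cls τ = Fin.last n ∧ k = lead τ) := fun h =>
        hne (hsolved.lead_injOn (h.1.trans hρ.1.symm) h.2.symm)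
      simp [hA, this]
    · simp
  have hdeg : topDegree der hcomm (R ρ * dop der (Fin.last n)) ≤ topDegree der hcomm (R ρ) := by
    rw [hsum]
    refine topDegree_sub_le der hcomm ((hr k ((hlead _).mp ⟨ρ, hρ.1, rfl⟩)).trans hle)
      (topDegree_sum_le der hcomm _ _ fun τ _ => ?_)
    refine (topDegree_mul_le der hcomm _ _).trans ?_
    rw [hA0, add_zero]
    by_cases hτ : cls τ = Fin.last n
    · by_cases h0 : R τ = 0
      · simp [h0, topDegree_zero]
      · exact hmax τ ⟨hτ, h0⟩
    · simp [topDegree_eq_zero_of_mem der hcomm (hR τ hτ)]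
  rw [topDegree_mul der hcomm hρ.2 (dop_ne_zero der hcomm _), topDegree_dop, if_pos rfl] at hdeg
  omega

/-- A restricted combination of the equations, in the coordinates with respect to the new
unknowns. -/
theorem sum_smul_lhs_eq
    (hlead : ∀ k : Fin m, (∃ τ, cls τ = Fin.last n ∧ lead τ = k) ↔ k.val < β)
    (R : Fin p → DiffOp der) : ∑ τ, R τ • lhs der (Φ τ) =
      ∑ k, (∑ τ, R τ * row der (rewriteJet der (shift Φ cls lead β) (Φ τ)) k) •
        ybar der Φ cls lead β k := by
  simp only [lhs_eq_sum_ybar (Φ := Φ) der hlead, Finset.smul_sum, Finset.sum_smul, mul_smul]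
  rw [Finset.sum_comm]

/-- The rewritten equations of class less than `n` do not contain the inputs. -/
theorem row_rewriteJet_eq_zero (hsolved : IsSolved Φ cls lead) (hinv : IsInvolutive der Φ cls)
    (hcomm : ∀ i j a, der i (der j a) = der j (der i a))
    (hlead : ∀ k : Fin m, (∃ τ, cls τ = Fin.last n ∧ lead τ = k) ↔ k.val < β)
    {τ : Fin p} (hτ : cls τ ≠ Fin.last n) {l : Fin m} (hl : β ≤ l.val) :
    row der (rewriteJet der (shift Φ cls lead β) (Φ τ)) l = 0 := by
  obtain ⟨R, hR, hsum⟩ := prolongation_mem_restrictedCombinations hinv τ (Fin.last n)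
  rw [sum_smul_lhs_eq hlead, lhs_eq_sum_ybar (Φ := Φ) der hlead, Finset.smul_sum] at hsum
  simp only [← mul_smul] at hsum
  have hcoord := congrFun (sum_smul_ybar_injective der hlead hsum)
  have hR0 : ∀ σ, topDegree der hcomm (R σ) = 0 := by
    intro σ
    by_cases hσ : cls σ = Fin.last n
    · by_cases h0 : R σ = 0
      · rw [h0, topDegree_zero]
      -- Here `r = 1`: along every unknown, `d_n Φ^τ` has as coordinate `d_n` times an operator of
      -- degree `0`.
      · refine Nat.lt_one_iff.mp (coefficient_topDegree_lt hcomm hsolved hlead hR ?_ hσ h0)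
        intro k _
        rw [← hcoord k]
        refine (topDegree_mul_le der hcomm _ _).trans ?_
        have h := row_rewriteJet_sub_mem_lowerOps (der := der) hsolved hlead τ k
        rw [if_neg fun h => hτ h.1, sub_zero] at h
        rw [topDegree_dop, if_pos rfl, topDegree_eq_zero_of_mem der hcomm h]
    · exact topDegree_eq_zero_of_mem der hcomm (hR σ hσ)
  by_contra hne
  have h1 := topDegree_mul der hcomm (dop_ne_zero der hcomm (Fin.last n)) hne
  rw [topDegree_dop, if_pos rfl, hcoord l] at h1
  have h2 : topDegree der hcomm
      (∑ σ, R σ * row der (rewriteJet der (shift Φ cls lead β) (Φ σ)) l) ≤ 0 := by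
    refine topDegree_sum_le der hcomm _ _ fun σ _ => ?_
    have h := row_rewriteJet_mem_lowerOps (der := der) hsolved hlead σ hl
    refine (topDegree_mul_le der hcomm _ _).trans ?_
    rw [hR0, topDegree_eq_zero_of_mem der hcomm h]
  omega

/-- Modulo the equations, the unknowns `ȳ^1, …, ȳ^β` only need coefficients in
`K[d_1, …, d_{n-1}]`. -/
theorem exists_reduced (hsolved : IsSolved Φ cls lead)
    (hlead : ∀ k : Fin m, (∃ τ, cls τ = Fin.last n ∧ lead τ = k) ↔ k.val < β)
    (v : Fin m → DiffOp der) : ∃ V : Fin m → DiffOp der,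
      (∀ k, k.val < β → V k ∈ lowerOps der) ∧
      v - ∑ k, V k • ybar der Φ cls lead β k ∈ eqModule der Φ := by
  let N : AddSubmonoid (Fin m → DiffOp der) :=
    { carrier := {v | ∃ V : Fin m → DiffOp der, (∀ k, k.val < β → V k ∈ lowerOps der) ∧
        v - ∑ k, V k • ybar der Φ cls lead β k ∈ eqModule der Φ}
      zero_mem' := ⟨0, fun _ _ => zero_mem _, by simp⟩
      add_mem' := by
        rintro v w ⟨V, hV, hv⟩ ⟨W, hW, hw⟩
        refine ⟨V + W, fun k hk => add_mem (hV k hk) (hW k hk), ?_⟩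
        convert! add_mem hv hw using 1
        simp only [Pi.add_apply, add_smul, Finset.sum_add_distrib]
        abel }
  have hsingle : ∀ (k : Fin m) (P : DiffOp der), (k.val < β → P ∈ lowerOps der) →
      P • ybar der Φ cls lead β k ∈ N := by
    intro k P hP
    refine ⟨Pi.single k P, fun j hj => ?_, ?_⟩
    · by_cases h : j = k
      · subst h; simpa using hP hj
      · rw [Pi.single_eq_of_ne h]; exact zero_mem _
    · rw [Finset.sum_eq_single k] <;> simp +contextual
  have heq : ∀ v ∈ eqModule der Φ, v ∈ N := fun v hv =>
    ⟨0, fun _ _ => zero_mem _, by simpa using hv⟩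
  have hlow : ∀ P ∈ lowerOps der, ∀ v ∈ N, P • v ∈ N := by
    rintro P hP v ⟨V, hV, hv⟩
    refine ⟨fun k => P * V k, fun k hk => mul_mem hP (hV k hk), ?_⟩
    convert! Submodule.smul_mem _ P hv using 1
    simp only [smul_sub, Finset.smul_sum, mul_smul]
  have hdop : ∀ k : Fin m, k.val < β →
      dop der (Fin.last n) • ybar der Φ cls lead β k ∈ N := by
    intro k hk
    obtain ⟨τ, hτ, rfl⟩ := (hlead k).mpr hk
    set A : Fin m → DiffOp der := fun k =>
      row der (rewriteJet der (shift Φ cls lead β) (Φ τ)) k -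
        (if cls τ = Fin.last n ∧ k = lead τ then dop der (Fin.last n) else 0) with hA
    -- The equation itself reads `d_n ȳ^k + ∑ A_j ȳ^j = 0`, with every `A_j` free of `d_n`.
    refine ⟨-A, fun j _ => neg_mem (row_rewriteJet_sub_mem_lowerOps hsolved hlead τ j), ?_⟩
    have h : lhs der (Φ τ) ∈ eqModule der Φ := Submodule.subset_span ⟨τ, rfl⟩
    convert! h using 1
    rw [lhs_eq_sum_ybar (Φ := Φ) der hlead]
    simp [hA, hτ, sub_smul, ite_smul]
  have hlast : ∀ v ∈ N, dop der (Fin.last n) • v ∈ N := by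
    rintro v ⟨V, hV, hv⟩
    rw [← sub_add_cancel v (∑ k, V k • ybar der Φ cls lead β k), smul_add, Finset.smul_sum]
    refine add_mem (heq _ (Submodule.smul_mem _ _ hv)) (sum_mem fun k _ => ?_)
    rcases lt_or_ge k.val β with hk | hk
    · have h : dop der (Fin.last n) • V k • ybar der Φ cls lead β k =
          V k • dop der (Fin.last n) • ybar der Φ cls lead β k +
            (dop der (Fin.last n) * V k - V k * dop der (Fin.last n)) •
              ybar der Φ cls lead β k := by
        rw [sub_smul, mul_smul, mul_smul]; abel
      rw [h]
      exact add_mem (hlow _ (hV k hk) _ (hdop k hk))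
        (hsingle k _ fun hk => commutator_mem_lowerOps der _ (hV k hk))
    -- Coefficients of inputs are unrestricted, so `d_n` is simply absorbed.
    · rw [← mul_smul]
      exact hsingle k _ fun h => absurd h hk.not_gt
  have hunk : ∀ k, unk der m k ∈ N := by
    intro k
    rw [unk_eq_ybar der hlead, sub_eq_add_neg, ← Finset.sum_neg_distrib]
    refine add_mem ?_ (sum_mem fun l _ => ?_)
    · rw [← one_smul (DiffOp der) (ybar der Φ cls lead β k)]
      exact hsingle k 1 fun _ => one_mem _
    · rw [← neg_smul]
      exact hsingle l _ fun _ => neg_mem (coeff_mem_lowerOps der _)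
  have hv : v ∈ N := by
    rw [← sum_smul_unk der v]
    exact sum_mem fun k _ => smul_mem_of_lowerOps der N hlow hlast _ (hunk k)
  exact hv

/-- The coordinates of a reduced representative of a torsion element along the inputs vanish. -/
theorem reduced_torsion_eq_zero (hsolved : IsSolved Φ cls lead) (hinv : IsInvolutive der Φ cls)
    (hcomm : ∀ i j a, der i (der j a) = der j (der i a))
    (hlead : ∀ k : Fin m, (∃ τ, cls τ = Fin.last n ∧ lead τ = k) ↔ k.val < β)
    {V : Fin m → DiffOp der} (hV : ∀ k, k.val < β → V k ∈ lowerOps der) {P : DiffOp der}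
    (hP : P ≠ 0) (h : P • ∑ k, V k • ybar der Φ cls lead β k ∈ eqModule der Φ)
    {l : Fin m} (hl : β ≤ l.val) : V l = 0 := by
  obtain ⟨R, hR, hsum⟩ := eqModule_le_restrictedCombinations hinv h
  rw [sum_smul_lhs_eq hlead, Finset.smul_sum] at hsum
  simp only [← mul_smul] at hsum
  have hcoord := congrFun (sum_smul_ybar_injective der hlead hsum)
  have hlt : ∀ σ, cls σ = Fin.last n → R σ ≠ 0 →
      topDegree der hcomm (R σ) < topDegree der hcomm P := fun σ =>
    coefficient_topDegree_lt hcomm hsolved hlead hR fun k hk => by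
      rw [← hcoord k]
      refine (topDegree_mul_le der hcomm _ _).trans ?_
      rw [topDegree_eq_zero_of_mem der hcomm (hV k hk), add_zero]
  by_contra hne
  have hPV := diffOp_mul_ne_zero der hcomm hP hne
  have hdeg := topDegree_mul der hcomm hP hne
  rw [hcoord l] at hPV hdeg
  have hterm : ∀ σ, R σ * row der (rewriteJet der (shift Φ cls lead β) (Φ σ)) l ≠ 0 →
      topDegree der hcomm (R σ * row der (rewriteJet der (shift Φ cls lead β) (Φ σ)) l) <
        topDegree der hcomm P := by
    intro σ h0
    by_cases hσ : cls σ = Fin.last n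
    · have h := row_rewriteJet_mem_lowerOps (der := der) hsolved hlead σ hl
      refine (topDegree_mul_le der hcomm _ _).trans_lt ?_
      rw [topDegree_eq_zero_of_mem der hcomm h, add_zero]
      exact hlt σ hσ (left_ne_zero_of_mul h0)
    · exact absurd (by rw [row_rewriteJet_eq_zero hsolved hinv hcomm hlead hσ hl, mul_zero]) h0
  -- A nonzero term forces `P` to have positive degree, so that subtracting `1` below does not
  -- truncate.
  obtain ⟨σ, -, hσ⟩ := Finset.exists_ne_zero_of_sum_ne_zero hPV
  have hpos := hterm σ hσ
  have hle := topDegree_sum_le der hcomm Finset.univ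
    (fun σ => R σ * row der (rewriteJet der (shift Φ cls lead β) (Φ σ)) l)
    (r := topDegree der hcomm P - 1) fun σ _ => by
      by_cases h0 : R σ * row der (rewriteJet der (shift Φ cls lead β) (Φ σ)) l = 0
      · simp [h0, topDegree_zero]
      · exact Nat.le_sub_one_of_lt (hterm σ h0)
  omega

end Torsion

end SpencerForm

end

/-! ### The rewritten system and its torsion elements -/

open SpencerForm
theorem theorem2p4 {K : Type*} [Field K] [CharZero K] {n m p : ℕ}
    (der : Fin (n + 1) → Derivation ℤ K K)
    (hcomm : ∀ i j a, der i (der j a) = der j (der i a))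
    (Φ : Fin p → Jet1 K (n + 1) m) (cls : Fin p → Fin (n + 1)) (lead : Fin p → Fin m)
    (hsolved : IsSolved Φ cls lead) (hinv : IsInvolutive der Φ cls)
    (β : ℕ) (hβ : β < m)
    (hlead : ∀ k : Fin m, (∃ τ, cls τ = Fin.last n ∧ lead τ = k) ↔ k.val < β) :
    -- the equations, written with the new unknowns, are first order equations `Ψ`
    (∃ Ψ : Fin p → Jet1 K (n + 1) m,
      (∀ τ, ∀ ψ : Jet1 K (n + 1) m,
        subst der (ybar der Φ cls lead β) ψ = lhs der (Φ τ) ↔ ψ = Ψ τ) ∧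
      -- class `n`: solved with respect to the new jets of class `n`, without inputs of class `n`
      (∀ τ, cls τ = Fin.last n →
        (∀ k : Fin m, k.val < β → Ψ τ (some (Fin.last n)) k = if k = lead τ then 1 else 0) ∧
        (∀ l : Fin m, β ≤ l.val → Ψ τ (some (Fin.last n)) l = 0)) ∧
      -- classes `1, …, n - 1`: the class does not increase, and no input and no jet of an input
      (∀ τ, cls τ ≠ Fin.last n →
        (∀ i k, cls τ < i → Ψ τ (some i) k = 0) ∧
        (∀ j, ∀ l : Fin m, β ≤ l.val → Ψ τ j l = 0))) ∧
    -- torsion elements only depend on the new unknowns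
    (∀ z : DiffModule der Φ, IsTorsionElement der Φ z →
      ∃ Q : Fin m → DiffOp der,
        (∀ k, Q k ∈ lowerOps der) ∧ (∀ k, β ≤ k.val → Q k = 0) ∧
        z = ∑ k, Q k • Submodule.Quotient.mk (ybar der Φ cls lead β k)) := by
  refine ⟨⟨fun τ => rewriteJet der (shift Φ cls lead β) (Φ τ), fun τ ψ => ?_, fun τ hτ =>
    rewriteJet_class_top der hsolved hlead hτ, fun τ hτ => ⟨fun i k hi =>
      rewriteJet_eq_zero_of_lt der hsolved _ hi k, fun j l hl => ?_⟩⟩, ?_⟩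
  · rw [subst_eq_sum_row, lhs_eq_sum_ybar (Φ := Φ) der hlead]
    refine ⟨fun h => ?_, by rintro rfl; rfl⟩
    funext j k
    -- Uniqueness has two layers: the `ȳ^k` are independent over `D`, and the operators `1, d_1, …,
    -- d_n` are independent over `K`.
    exact row_injective hcomm (congrFun (sum_smul_ybar_injective der hlead h) k) j
  · refine row_injective hcomm (ψ := 0) ?_ j
    rw [row_rewriteJet_eq_zero hsolved hinv hcomm hlead hτ hl]
    simp [row]
  · rintro z ⟨P, hP, hPz⟩
    obtain ⟨v, rfl⟩ := Submodule.Quotient.mk_surjective _ z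
    obtain ⟨V, hV, hv⟩ := exists_reduced hsolved hlead v
    have hz : (Submodule.Quotient.mk v : DiffModule der Φ) =
        ∑ k, V k • Submodule.Quotient.mk (ybar der Φ cls lead β k) := by
      rw [(Submodule.Quotient.eq _).mpr hv]
      exact map_sum (eqModule der Φ).mkQ _ _
    -- The annihilator of `z` also kills its reduced representative modulo the equations.
    have hmem : P • ∑ k, V k • ybar der Φ cls lead β k ∈ eqModule der Φ := by
      rw [← Submodule.Quotient.mk_eq_zero, Submodule.Quotient.mk_smul,
        ← (Submodule.Quotient.eq _).mpr hv]
      exact hPz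
    have hV0 : ∀ k : Fin m, β ≤ k.val → V k = 0 := fun k hk =>
      reduced_torsion_eq_zero hsolved hinv hcomm hlead hV hP hmem hk
    refine ⟨V, fun k => ?_, hV0, hz⟩
    rcases lt_or_ge k.val β with hk | hk
    · exact hV k hk
    · rw [hV0 k hk]; exact zero_mem _
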